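/- **Exchangeability of the $N$-particle system.** Let $N, d \in \mathbb{N}$ and $T > 0$, let $f : \mathbb{R} \times \mathbb{R}^d \to \mathbb{R}^d$, $(t,x) \mapsto f_t(x)$, and $\sigma : \mathbb{R} \to \mathbb{R}$, $t \mapsto \sigma_t$, be Borel measurable, and let $\zeta_t(x)$ be jointly Borel measurable in $(t,x)$ and such that for each $t \in [0,T)$, $\zeta_t$ is an everywhere positive, differentiable probability density on $\mathbb{R}^d$ (for instance the marginal densities of a noising diffusion, in either direction of time). Assume that the drift $$b_t(x) = f_t(x) - \sigma_t^2 \nabla \log \zeta_t(x)$$ is locally Lipschitz in $x$, locally uniformly in $t \in [0,T)$: for all $T' < T$ and $R$ there is $L < \infty$ with $\|b_t(x) - b_t(y)\| \le L \|x-y\|$ for all $t \in [0,T']$ and $\|x\|, \|y\| \le R$. Let $(\Omega, \mathcal{F}, (\mathcal{F}_t), \mathbb{P})$ be a filtered probability space, let $B^1, \dots, B^N$ be independent $d$-dimensional standard Wiener processes relative to $(\mathcal{F}_t)$, and let $\mathbf{X}^N_t = (X^1_t, \dots, X^N_t)$, $t\in[0,T]$, be adapted with almost surely continuous paths and solve the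 denoising mean-field SDEs $$dX^{i}_t = \big[f_t(X^{i}_t) - \sigma_t^2 \nabla \log \zeta_t(X^{i}_t)\big]\,dt + \sigma_t\, dB^{i}_t, \qquad 1 \le i \le N, \quad t \in [0,T],$$ where almost surely $\int_0^T \|b_t(X^i_t)\|\,dt < \infty$ and $\int_0^T \sigma_t^2\,dt < \infty$. Assume that the initial states $X^1_0, \dots, X^N_0$ are i.i.d. standard Gaussian vectors in $\mathbb{R}^d$, i.e. $\mathbf{X}^N_0 \sim \mathcal{N}(0, \mathbf{I}_d)^{\otimes N}$. Then for every $t \in (0,T]$ the particles $X^1_t, \dots, X^N_t$ are exchangeable: for every permutation $\tau \in S_N$, $(X^{\tau(1)}_t, \dots, X^{\tau(N)}_t)$ and $(X^1_t, \dots, X^N_t)$ have the same law. In particular, if this law has a density $\varrho^N_t$ with respect to Lebesgue measure on $(\mathbb{R}^d)^N$, then for every $\tau \in S_N$, $\varrho^N_t(x_{\tau(1)}, \dots, x_{\tau(N)}) = \varrho^N_t(x_1, \dots, x_N)$ for almost every $(x_1,\dots,x_N)$. -/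

import Mathlib

open MeasureTheory ProbabilityTheory Filter Topology
open scoped NNReal ENNReal

noncomputable section

namespace MeanFieldSDE

/-- The state space of one particle: `ℝ^d` with the Euclidean norm. -/
abbrev Particle (d : ℕ) : Type := EuclideanSpace ℝ (Fin d)

/-! ### Stochastic integral of a deterministic square-integrable function -/

/-- A real step function `∑ k, c k • 1_{(a k, b k]}` on the half-line. -/
structure StepFunction where
  n : ℕ
  left : Fin n → ℝ≥0
  right : Fin n → ℝ≥0
  left_le_right : ∀ k, left k ≤ right k
  coeff : Fin n → ℝ

/-- The value of the step function at time `s`. -/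
def StepFunction.toFun (g : StepFunction) (s : ℝ) : ℝ :=
  ∑ k, (Set.Ioc (g.left k : ℝ) (g.right k : ℝ)).indicator (fun _ => g.coeff k) s

/-- The elementary stochastic integral of the step function against the process `B` over `[0, t]`,
`∑ k, c k • (B (b k ∧ t) - B (a k ∧ t))`. -/
def StepFunction.integral {d : ℕ} {Ω : Type*} (g : StepFunction) (B : ℝ≥0 → Ω → Particle d)
    (t : ℝ≥0) (ω : Ω) : Particle d :=
  ∑ k, g.coeff k • (B (min (g.right k) t) ω - B (min (g.left k) t) ω)

/-- `I` is (a version of) the stochastic integral `∫_0^t σ_s dB_s` of the deterministic function `σ`: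
`σ` is square-integrable on `[0, t]`, and the elementary integrals of step functions that
approximate `σ` in `L²([0, t])` converge to `I` in `L²(P)`. -/
structure IsStochasticIntegral {d : ℕ} {Ω : Type*} {mΩ : MeasurableSpace Ω} (P : Measure Ω)
    (σ : ℝ → ℝ) (B : ℝ≥0 → Ω → Particle d) (t : ℝ≥0) (I : Ω → Particle d) : Prop where
  memLp : MemLp σ 2 (volume.restrict (Set.Icc (0 : ℝ) t))
  tendsto : ∀ g : ℕ → StepFunction,
    Tendsto (fun n => eLpNorm (fun s => (g n).toFun s - σ s) 2
      (volume.restrict (Set.Icc (0 : ℝ) t))) atTop (𝓝 0) →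
    Tendsto (fun n => eLpNorm (fun ω => (g n).integral B t ω - I ω) 2 P) atTop (𝓝 0)

/-! ### Independent Wiener processes -/

/-- `B 0, …, B (N - 1)` are independent `d`-dimensional standard Wiener processes relative to the
filtration `ℱ`: all the coordinate processes are independent real Brownian motions, the processes
are adapted, and their increments after time `s` are jointly independent of `ℱ s`. -/
structure IsIndepWienerFamily {d N : ℕ} {Ω : Type*} {mΩ : MeasurableSpace Ω} (P : Measure Ω)
    (ℱ : Filtration ℝ≥0 mΩ) (B : Fin N → ℝ≥0 → Ω → Particle d) : Prop where
  brownian : ∀ i k, IsBrownianReal (fun t ω => B i t ω k) P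
  indep : iIndepFun (fun (p : Fin N × Fin d) (ω : Ω) (t : ℝ≥0) => B p.1 t ω p.2) P
  adapted : ∀ i, Adapted ℱ (B i)
  indep_past : ∀ s : ℝ≥0, Indep (ℱ s) (MeasurableSpace.comap
    (fun (ω : Ω) (i : Fin N) (u : ℝ≥0) => B i (s + u) ω - B i s ω) inferInstance) P

/-! ### The denoising mean-field SDEs -/

/-- `ρ` is an everywhere positive, differentiable probability density on `ℝ^d`, so that its score
`∇ log ρ` is defined everywhere. -/
structure IsScoreDensity {d : ℕ} (ρ : Particle d → ℝ) : Prop where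
  pos : ∀ x, 0 < ρ x
  differentiable : Differentiable ℝ ρ
  lintegral_eq_one : ∫⁻ x, ENNReal.ofReal (ρ x) = 1

/-- The drift `f_t(x) - σ_t² ∇ log ζ_t(x)` of the denoising mean-field SDEs. -/
def denoisingDrift {d : ℕ} (f : ℝ → Particle d → Particle d) (σ : ℝ → ℝ)
    (ζ : ℝ → Particle d → ℝ) (t : ℝ) (x : Particle d) : Particle d :=
  f t x - (σ t) ^ 2 • gradient (fun y => Real.log (ζ t y)) x

/-- `X 0, …, X (N - 1)` solve on `[0, T]` the denoising mean-field SDEs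
`dX^i_t = [f_t(X^i_t) - σ_t² ∇ log ζ_t(X^i_t)] dt + σ_t dB^i_t`: they are adapted, have almost surely
continuous paths and integrable drift, and for each `t ≤ T` the difference
`X^i_t - X^i_0 - ∫_0^t (drift) ds` is the stochastic integral `∫_0^t σ_s dB^i_s`. -/
structure IsDenoisingSolution {d N : ℕ} {Ω : Type*} {mΩ : MeasurableSpace Ω} (P : Measure Ω)
    (ℱ : Filtration ℝ≥0 mΩ) (T : ℝ≥0) (f : ℝ → Particle d → Particle d) (σ : ℝ → ℝ)
    (ζ : ℝ → Particle d → ℝ) (B X : Fin N → ℝ≥0 → Ω → Particle d) : Prop where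
  wiener : IsIndepWienerFamily P ℱ B
  adapted : ∀ i, Adapted ℱ (X i)
  continuousOn : ∀ i, ∀ᵐ ω ∂P, ContinuousOn (fun t => X i t ω) (Set.Iic T)
  integrableOn : ∀ i, ∀ᵐ ω ∂P, IntegrableOn
    (fun s : ℝ => denoisingDrift f σ ζ s (X i s.toNNReal ω)) (Set.Icc (0 : ℝ) T)
  equation : ∀ i, ∀ t ≤ T, IsStochasticIntegral P σ (B i) t (fun ω =>
    X i t ω - X i 0 ω - ∫ s in (0 : ℝ)..t, denoisingDrift f σ ζ s (X i s.toNNReal ω))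

/-! ### Exchangeability -/

/-- The random variables `Y i` are exchangeable: permuting them does not change their joint law. -/
def Exchangeable {ι Ω E : Type*} [MeasurableSpace E] {mΩ : MeasurableSpace Ω} (P : Measure Ω)
    (Y : ι → Ω → E) : Prop :=
  ∀ τ : Equiv.Perm ι, IdentDistrib (fun ω i => Y (τ i) ω) (fun ω i => Y i ω) P P

end MeanFieldSDE

end

/-!
Every particle is one and the same measurable functional `Φ` of its own initial state and its own
Brownian increments, `X^i = Φ(X^i_0, B^i - B^i_0)`. Indeed the Wiener integrals `∫_0^t σ_s dB^i_s`
are limits, along one subsequence for all `i`, of the same linear functionals of the increments, and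
by Grönwall's inequality the path `X^i` is determined by the noise terms
`X^i_t - ∫_0^t b_s(X^i_s) ds`; the Lusin–Souslin theorem makes the inverse of this injective map
measurable. The initial states are exchangeable, so are the increments, and the two are independent;
hence the pairs `(X^i_0, B^i - B^i_0)` are exchangeable, and applying `Φ` to each of them preserves
this.
-/

namespace MeanFieldSDE

section Exchangeable

variable {ι Ω E F : Type*} {mΩ : MeasurableSpace Ω} {P : Measure Ω} [MeasurableSpace E]
  [MeasurableSpace F] {Y Z : ι → Ω → E}

lemma Exchangeable.comp (hY : Exchangeable P Y) {φ : E → F} (hφ : Measurable φ) :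
    Exchangeable P fun i ω => φ (Y i ω) := fun τ =>
  (hY τ).comp (u := fun y i => φ (y i)) (by fun_prop)

lemma Exchangeable.congr [Countable ι] (hY : Exchangeable P Y) (h : ∀ i, Y i =ᵐ[P] Z i) :
    Exchangeable P Z := by
  intro τ
  have hperm : ∀ τ : Equiv.Perm ι, (fun ω i => Y (τ i) ω) =ᵐ[P] fun ω i => Z (τ i) ω := by
    intro τ
    filter_upwards [ae_all_iff.2 fun i => h (τ i)] with ω hω using funext hω
  exact ((IdentDistrib.of_ae_eq (hY τ).aemeasurable_fst (hperm τ)).symm.trans (hY τ)).trans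
    (IdentDistrib.of_ae_eq (hY τ).aemeasurable_snd (hperm 1))

lemma Exchangeable.prodMk [IsFiniteMeasure P] {W : ι → Ω → F} (hY : Exchangeable P Y)
    (hW : Exchangeable P W) (hYW : IndepFun (fun ω i => Y i ω) (fun ω i => W i ω) P) :
    Exchangeable P fun i ω => (Y i ω, W i ω) := by
  intro τ
  have hYWτ : IndepFun (fun ω i => Y (τ i) ω) (fun ω i => W (τ i) ω) P :=
    hYW.comp (φ := fun (y : ι → E) i => y (τ i)) (ψ := fun (w : ι → F) i => w (τ i))
      (by fun_prop) (by fun_prop)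
  exact ((hY τ).prodMk (hW τ) hYWτ hYW).comp
    (u := fun p : (ι → E) × (ι → F) => fun i => (p.1 i, p.2 i)) (by fun_prop)

lemma exchangeable_of_iIndepFun_identDistrib [Countable ι] (hY : iIndepFun Y P)
    (hident : ∀ i j, IdentDistrib (Y i) (Y j) P P) : Exchangeable P Y := fun τ =>
  IdentDistrib.pi (fun i => hident (τ i) i) (hY.precomp τ.injective) hY

lemma exchangeable_of_hasLaw_pi [Fintype ι] {μ : Measure E} [IsProbabilityMeasure μ]
    (hY : HasLaw (fun ω i => Y i ω) (Measure.pi fun _ => μ) P) : Exchangeable P Y := by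
  have : IsProbabilityMeasure P := hY.isProbabilityMeasure
  have hYi : ∀ i, HasLaw (Y i) μ P := fun i => (measurePreserving_eval _ i).fun_comp_hasLaw hY
  exact exchangeable_of_iIndepFun_identDistrib ((iIndepFun_iff_hasLaw_pi_pi hYi).2 hY)
    fun i j => (hYi i).identDistrib (hYi j)

/-- Both `ϱ` and `ϱ ∘ e` are densities of `ν.withDensity ϱ`, since it and `ν` are `e`-invariant. -/
lemma comp_ae_eq_of_measurePreserving_withDensity {α : Type*} [MeasurableSpace α] {ν : Measure α}
    [SigmaFinite ν] {e : α ≃ᵐ α} (he : MeasurePreserving e ν ν) {ϱ : α → ℝ≥0∞}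
    (hϱ : Measurable ϱ) (heϱ : MeasurePreserving e (ν.withDensity ϱ) (ν.withDensity ϱ)) :
    ϱ ∘ e =ᵐ[ν] ϱ := by
  refine (withDensity_eq_iff_of_sigmaFinite (hϱ.comp e.measurable).aemeasurable
    hϱ.aemeasurable).1 (Measure.ext fun A hA => ?_)
  have hpre : e ⁻¹' (e.symm ⁻¹' A) = A := by rw [← Set.preimage_comp, e.symm_comp_self]; rfl
  have hA' : MeasurableSet (e.symm ⁻¹' A) := e.symm.measurable hA
  calc ν.withDensity (ϱ ∘ e) A = ∫⁻ x in e ⁻¹' (e.symm ⁻¹' A), ϱ (e x) ∂ν := by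
        rw [withDensity_apply _ hA, hpre]; rfl
    _ = ∫⁻ x in e.symm ⁻¹' A, ϱ x ∂ν := he.setLIntegral_comp_preimage hA' hϱ
    _ = ν.withDensity ϱ (e.symm ⁻¹' A) := (withDensity_apply _ hA').symm
    _ = ν.withDensity ϱ A := by rw [← heϱ.measure_preimage hA'.nullMeasurableSet, hpre]

lemma Exchangeable.density_comp_perm [Fintype ι] {μ : Measure E} [SigmaFinite μ]
    (hY : Exchangeable P Y) {ϱ : (ι → E) → ℝ≥0∞} (hϱ : Measurable ϱ)
    (hmap : P.map (fun ω i => Y i ω) = (Measure.pi fun _ => μ).withDensity ϱ)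
    (τ : Equiv.Perm ι) : (fun x => ϱ fun i => x (τ i)) =ᵐ[Measure.pi fun _ => μ] ϱ := by
  let e : (ι → E) ≃ᵐ (ι → E) := .arrowCongr' τ.symm (.refl E)
  have he : MeasurePreserving e (Measure.pi fun _ => μ) (Measure.pi fun _ => μ) :=
    measurePreserving_arrowCongr' (fun _ => μ) (fun _ => μ) τ.symm (.refl E)
      fun _ => MeasurePreserving.id μ
  refine comp_ae_eq_of_measurePreserving_withDensity he hϱ ⟨e.measurable, ?_⟩
  rw [← hmap, AEMeasurable.map_map_of_aemeasurable e.measurable.aemeasurable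
    (hY τ).aemeasurable_snd]
  exact (hY τ).map_eq

end Exchangeable

section IntegralEquation

variable {E : Type*} [NormedAddCommGroup E] {a c : ℝ}

/-- The drift `b` is locally Lipschitz in space, locally uniformly in the time `t ∈ [a, c)`; this is
the condition under which an integral equation on `[a, c]` with drift `b` determines its solution.
No bound is required to hold up to the terminal time `c`. -/
def IsLocallyLipschitzBefore (a c : ℝ) (b : ℝ → E → E) : Prop :=
  ∀ T' : ℝ, T' < c → ∀ R : ℝ, ∃ L : ℝ≥0, ∀ t ∈ Set.Icc a T',
    LipschitzOnWith L (b t) (Metric.closedBall 0 R)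

lemma IsLocallyLipschitzBefore.congr {b b' : ℝ → E → E} (hb : IsLocallyLipschitzBefore a c b)
    (h : Set.EqOn b b' (Set.Ico a c)) : IsLocallyLipschitzBefore a c b' := by
  intro T' hT' R
  obtain ⟨L, hL⟩ := hb T' hT' R
  exact ⟨L, fun t ht => h ⟨ht.1, ht.2.trans_lt hT'⟩ ▸ hL t ht⟩

lemma eq_zero_of_le_mul_integral {v : ℝ → ℝ} (hv : Continuous v) (hv0 : ∀ t, 0 ≤ v t) {L : ℝ≥0}
    (h : ∀ t ∈ Set.Icc a c, v t ≤ L * ∫ s in a..t, v s) : ∀ t ∈ Set.Icc a c, v t = 0 := by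
  let u : ℝ → ℝ := fun t => ∫ s in a..t, v s
  have hu' : ∀ t, HasDerivAt u (v t) t := fun t => hv.integral_hasStrictDerivAt a t |>.hasDerivAt
  have hu0 : ∀ t ∈ Set.Icc a c, 0 ≤ u t := fun t ht =>
    intervalIntegral.integral_nonneg ht.1 fun s _ => hv0 s
  have hgronwall : ∀ t ∈ Set.Icc a c, ‖u t‖ ≤ gronwallBound 0 L 0 (t - a) := by
    refine norm_le_gronwallBound_of_norm_deriv_right_le
      (fun t _ => (hu' t).continuousAt.continuousWithinAt)
      (fun t _ => (hu' t).hasDerivWithinAt) (by simp [u]) fun t ht => ?_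
    have ht' := Set.Ico_subset_Icc_self ht
    simpa [abs_of_nonneg, hv0 t, hu0 t ht'] using h t ht'
  intro t ht
  have hut : ∫ s in a..t, v s = 0 := by simpa [u, gronwallBound_ε0] using hgronwall t ht
  exact le_antisymm ((h t ht).trans_eq (by rw [hut, mul_zero])) (hv0 t)

variable [NormedSpace ℝ E]

lemma norm_sub_le_mul_integral_norm_sub {b : ℝ → E → E} {R : ℝ} {L : ℝ≥0}
    (hL : ∀ t ∈ Set.Icc a c, LipschitzOnWith L (b t) (Metric.closedBall 0 R)) {x y : ℝ → E}
    (hx : Continuous x) (hy : Continuous y)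
    (hxR : ∀ t ∈ Set.Icc a c, ‖x t‖ ≤ R) (hyR : ∀ t ∈ Set.Icc a c, ‖y t‖ ≤ R)
    (hxi : IntegrableOn (fun s => b s (x s)) (Set.Icc a c))
    (hyi : IntegrableOn (fun s => b s (y s)) (Set.Icc a c))
    {t : ℝ} (ht : t ∈ Set.Icc a c)
    (h : x t - ∫ s in a..t, b s (x s) = y t - ∫ s in a..t, b s (y s)) :
    ‖x t - y t‖ ≤ L * ∫ s in a..t, ‖x s - y s‖ := by
  have hint : ∀ {z : ℝ → E}, IntegrableOn (fun s => b s (z s)) (Set.Icc a c) →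
      IntervalIntegrable (fun s => b s (z s)) volume a t := fun hz =>
    (intervalIntegrable_iff_integrableOn_Icc_of_le ht.1).2
      (hz.mono_set (Set.Icc_subset_Icc_right ht.2))
  have hsub : x t - y t = ∫ s in a..t, (b s (x s) - b s (y s)) := by
    rw [intervalIntegral.integral_sub (hint hxi) (hint hyi)]
    exact sub_eq_sub_iff_sub_eq_sub.1 h
  rw [hsub, ← intervalIntegral.integral_const_mul]
  refine intervalIntegral.norm_integral_le_of_norm_le ht.1 (ae_of_all _ fun s hs => ?_)
    (((hx.sub hy).norm.const_mul _).intervalIntegrable _ _)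
  have hs' : s ∈ Set.Icc a c := ⟨hs.1.le, hs.2.trans ht.2⟩
  exact (hL s hs').norm_sub_le (by simpa using hxR s hs') (by simpa using hyR s hs')

lemma IsLocallyLipschitzBefore.eqOn_of_sub_integral_eq {b : ℝ → E → E}
    (hb : IsLocallyLipschitzBefore a c b) {x y : ℝ → E} (hx : Continuous x) (hy : Continuous y)
    (hxi : IntegrableOn (fun s => b s (x s)) (Set.Icc a c))
    (hyi : IntegrableOn (fun s => b s (y s)) (Set.Icc a c))
    (h : ∀ t ∈ Set.Icc a c,
      x t - ∫ s in a..t, b s (x s) = y t - ∫ s in a..t, b s (y s)) :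
    Set.EqOn x y (Set.Icc a c) := by
  have hIco : Set.EqOn x y (Set.Ico a c) := by
    intro T' hT'
    have hsub : Set.Icc a T' ⊆ Set.Icc a c := Set.Icc_subset_Icc_right hT'.2.le
    obtain ⟨Cx, hCx⟩ :=
      isCompact_Icc.exists_bound_of_continuousOn (s := Set.Icc a T') hx.continuousOn
    obtain ⟨Cy, hCy⟩ :=
      isCompact_Icc.exists_bound_of_continuousOn (s := Set.Icc a T') hy.continuousOn
    obtain ⟨L, hL⟩ := hb T' hT'.2 (max Cx Cy)
    have hzero := eq_zero_of_le_mul_integral (hx.sub hy).norm (fun _ => norm_nonneg _)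
      fun t ht => norm_sub_le_mul_integral_norm_sub hL hx hy
        (fun s hs => le_max_of_le_left (hCx s hs)) (fun s hs => le_max_of_le_right (hCy s hs))
        (hxi.mono_set hsub) (hyi.mono_set hsub) ht (h t (hsub ht))
    exact sub_eq_zero.1 (norm_eq_zero.1 (hzero T' (Set.right_mem_Icc.2 hT'.1)))
  rcases eq_or_ne a c with rfl | hac
  · intro t ht
    obtain rfl : t = a := by simpa using ht
    simpa using h t ht
  · simpa only [closure_Ico hac] using hIco.closure hx hy

end IntegralEquation

section MeasurableGradient

variable {α E : Type*} [MeasurableSpace α] [NormedAddCommGroup E] [MeasurableSpace E]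
  [BorelSpace E] {g : α → E → ℝ}

lemma measurable_fderiv_apply_of_measurable_uncurry [NormedSpace ℝ E]
    (hg : Measurable (Function.uncurry g)) (hd : ∀ r, Differentiable ℝ (g r)) (v : E) :
    Measurable fun p : α × E => fderiv ℝ (g p.1) p.2 v := by
  refine measurable_of_tendsto_metrizable (f := fun (n : ℕ) (p : α × E) =>
    (n : ℝ) • (g p.1 (p.2 + (n : ℝ)⁻¹ • v) - g p.1 p.2)) (fun n => ?_)
    (tendsto_pi_nhds.2 fun p => (hd p.1 p.2).hasFDerivAt.lim v
      (by simpa using tendsto_natCast_atTop_atTop))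
  have hshift : Measurable fun p : α × E => g p.1 (p.2 + (n : ℝ)⁻¹ • v) :=
    hg.comp (measurable_fst.prodMk (measurable_snd.add_const _))
  have hbase : Measurable fun p : α × E => g p.1 p.2 := hg
  exact (hshift.sub hbase).const_smul (n : ℝ)

lemma measurable_gradient_of_measurable_uncurry [InnerProductSpace ℝ E] [FiniteDimensional ℝ E]
    (hg : Measurable (Function.uncurry g)) (hd : ∀ r, Differentiable ℝ (g r)) :
    Measurable fun p : α × E => gradient (g p.1) p.2 := by
  let e := stdOrthonormalBasis ℝ E
  have hgrad : ∀ p : α × E, gradient (g p.1) p.2 = ∑ k, fderiv ℝ (g p.1) p.2 (e k) • e k := by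
    intro p
    simp only [← inner_gradient_left, real_inner_comm (e _), e.sum_repr']
  simp only [hgrad]
  exact Finset.measurable_sum _ fun k _ =>
    (measurable_fderiv_apply_of_measurable_uncurry hg hd (e k)).smul_const (e k)

end MeasurableGradient

section MeasurableDrift

variable {d : ℕ} {f : ℝ → Particle d → Particle d} {σ : ℝ → ℝ} {ζ : ℝ → Particle d → ℝ}

lemma measurable_denoisingDrift (hf : Measurable (Function.uncurry f)) (hσ : Measurable σ)
    (hζ : Measurable (Function.uncurry ζ)) (hd : ∀ t, Differentiable ℝ (ζ t))
    (h0 : ∀ t x, ζ t x ≠ 0) : Measurable (Function.uncurry (denoisingDrift f σ ζ)) := by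
  have hscore := measurable_gradient_of_measurable_uncurry
    (g := fun t y => Real.log (ζ t y)) (Real.measurable_log.comp hζ)
    fun t => (hd t).log (h0 t)
  exact hf.sub (((hσ.comp measurable_fst).pow_const 2).smul hscore)

/-- The density may be anything outside the times `S`; it is replaced there by `1`, which makes the
drift jointly measurable. -/
lemma exists_measurable_eqOn_denoisingDrift (hf : Measurable (Function.uncurry f))
    (hσ : Measurable σ) (hζ : Measurable (Function.uncurry ζ)) {S : Set ℝ} (hS : MeasurableSet S)
    (hζS : ∀ t ∈ S, IsScoreDensity (ζ t)) :
    ∃ b : ℝ → Particle d → Particle d, Measurable (Function.uncurry b) ∧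
      Set.EqOn (denoisingDrift f σ ζ) b S := by
  classical
  have hS' : MeasurableSet (Prod.fst ⁻¹' S : Set (ℝ × Particle d)) := measurable_fst hS
  let ζ' : ℝ → Particle d → ℝ := fun t x => if t ∈ S then ζ t x else 1
  have hζ' : Measurable (Function.uncurry ζ') := .ite hS' hζ measurable_const
  refine ⟨denoisingDrift f σ ζ', measurable_denoisingDrift hf hσ hζ' ?_ ?_, ?_⟩
  · intro t
    by_cases ht : t ∈ S
    · simpa [ζ', ht] using (hζS t ht).differentiable
    · simp [ζ', ht]
  · intro t x
    by_cases ht : t ∈ S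
    · simpa [ζ', ht] using ((hζS t ht).pos x).ne'
    · simp [ζ', ht]
  · intro t ht
    ext1 x
    simp [denoisingDrift, ζ', ht]

end MeasurableDrift

section StepFunctionDensity

/-- The step function that interpolates `g` on `(0, t]` at the right ends of `n` equal intervals. -/
noncomputable def StepFunction.interpolate (g : ℝ → ℝ) (t : ℝ≥0) (n : ℕ) : StepFunction where
  n := n
  left k := (k : ℝ≥0) * (t / n)
  right k := ((k : ℝ≥0) + 1) * (t / n)
  left_le_right k := by gcongr; simp
  coeff k := g (((k : ℝ) + 1) * (t / n))

lemma StepFunction.measurable_toFun (g : StepFunction) : Measurable g.toFun := by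
  unfold toFun
  exact Finset.measurable_fun_sum _ fun k _ => measurable_const.indicator measurableSet_Ioc

variable {g : ℝ → ℝ} {t : ℝ≥0}

lemma ceil_div_mul_mem_Icc {n : ℕ} (hn : n ≠ 0) {s : ℝ} (hs : s ∈ Set.Ioc (0 : ℝ) t) :
    ⌈s / (t / n)⌉₊ * ((t : ℝ) / n) ∈ Set.Icc s (s + t / n) ∩ Set.Icc (0 : ℝ) t := by
  have hδ : (0 : ℝ) < t / n := div_pos (hs.1.trans_le hs.2) (by positivity)
  have hle : ⌈s / (t / n)⌉₊ ≤ n := by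
    rw [Nat.ceil_le, div_le_iff₀ hδ, mul_div_cancel₀ _ (by positivity)]
    exact hs.2
  refine ⟨⟨(div_le_iff₀ hδ).1 (Nat.le_ceil _), ?_⟩, by positivity, ?_⟩
  · calc ⌈s / (t / n)⌉₊ * ((t : ℝ) / n) ≤ (s / (t / n) + 1) * (t / n) := by
          gcongr
          exact (Nat.ceil_lt_add_one (by have := hs.1; positivity)).le
      _ = s + t / n := by rw [add_mul, div_mul_cancel₀ _ hδ.ne', one_mul]
  · calc ⌈s / (t / n)⌉₊ * ((t : ℝ) / n) ≤ n * (t / n) := by gcongr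
      _ = t := mul_div_cancel₀ _ (by positivity)

lemma StepFunction.interpolate_toFun {n : ℕ} (hn : n ≠ 0) {s : ℝ} (hs : s ∈ Set.Ioc (0 : ℝ) t) :
    (interpolate g t n).toFun s = g (⌈s / (t / n)⌉₊ * (t / n)) := by
  have hδ : (0 : ℝ) < t / n := div_pos (hs.1.trans_le hs.2) (by positivity)
  have hmem : ∀ k : ℕ, s ∈ Set.Ioc (k * ((t : ℝ) / n)) ((k + 1) * (t / n)) ↔
      ⌈s / (t / n)⌉₊ = k + 1 := by
    intro k
    rw [Nat.ceil_eq_iff k.succ_ne_zero, Set.mem_Ioc, lt_div_iff₀ hδ, div_le_iff₀ hδ]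
    simp
  obtain ⟨k, hk⟩ : ∃ k, ⌈s / (t / n)⌉₊ = k + 1 :=
    Nat.exists_eq_succ_of_ne_zero (Nat.ceil_pos.2 (div_pos hs.1 hδ)).ne'
  have hkn : k < n := by
    have hle : ((k + 1 : ℕ) : ℝ) * (t / n) ≤ n * (t / n) := by
      rw [← hk, mul_div_cancel₀ _ (by positivity)]
      exact (ceil_div_mul_mem_Icc hn hs).2.2
    exact Nat.cast_le.1 (le_of_mul_le_mul_right hle hδ)
  calc (interpolate g t n).toFun s
      = ∑ j : Fin n, if j = ⟨k, hkn⟩ then g (⌈s / (t / n)⌉₊ * (t / n)) else 0 := by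
        refine Finset.sum_congr rfl fun j _ => ?_
        simp only [interpolate, NNReal.coe_mul, NNReal.coe_add, NNReal.coe_natCast, NNReal.coe_one,
          NNReal.coe_div, Set.indicator_apply, hmem, hk, add_left_inj]
        split_ifs <;> grind
    _ = g (⌈s / (t / n)⌉₊ * (t / n)) := by simp

lemma exists_dist_interpolate_le (hg : ContinuousOn g (Set.Icc 0 t)) {η : ℝ} (hη : 0 < η) :
    ∃ n, ∀ s ∈ Set.Ioc (0 : ℝ) t, dist ((StepFunction.interpolate g t n).toFun s) (g s) ≤ η := by
  obtain ⟨r, hr, hrη⟩ := Metric.uniformContinuousOn_iff.1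
    (isCompact_Icc.uniformContinuousOn_of_continuous hg) η hη
  obtain ⟨n, hn⟩ := exists_nat_gt ((t : ℝ) / r)
  have hn0 : (0 : ℝ) < n := (by positivity : (0 : ℝ) ≤ t / r).trans_lt hn
  refine ⟨n, fun s hs => ?_⟩
  have hn' : n ≠ 0 := by exact_mod_cast hn0.ne'
  obtain ⟨⟨hsq, hqs⟩, hq⟩ := ceil_div_mul_mem_Icc hn' hs
  rw [StepFunction.interpolate_toFun hn' hs]
  refine (hrη _ hq s (Set.Ioc_subset_Icc_self hs) ?_).le
  rw [Real.dist_eq, abs_of_nonneg (sub_nonneg.2 hsq)]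
  exact (sub_le_iff_le_add'.2 hqs).trans_lt (div_lt_comm₀ hr hn0 |>.1 hn)

lemma exists_stepFunction_eLpNorm_sub_le_of_continuousOn (hg : ContinuousOn g (Set.Icc 0 t))
    (p : ℝ≥0∞) {ε : ℝ≥0∞} (hε : ε ≠ 0) :
    ∃ h : StepFunction, eLpNorm (h.toFun - g) p (volume.restrict (Set.Icc (0 : ℝ) t)) ≤ ε := by
  rw [← restrict_Ioc_eq_restrict_Icc]
  set μ := volume.restrict (Set.Ioc (0 : ℝ) t)
  obtain ⟨η, hη, hηε⟩ : ∃ η : ℝ≥0, 0 < η ∧ η * μ Set.univ ^ p.toReal⁻¹ < ε :=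
    ENNReal.exists_nnreal_pos_mul_lt
      (ENNReal.rpow_ne_top_of_nonneg (by positivity) (by simp [μ])) hε
  obtain ⟨n, hn⟩ := exists_dist_interpolate_le hg (NNReal.coe_pos.2 hη)
  refine ⟨.interpolate g t n, (eLpNorm_le_of_ae_bound (C := η) ?_).trans ?_⟩
  · refine (ae_restrict_iff' measurableSet_Ioc).2 (ae_of_all _ fun s hs => ?_)
    simpa [← dist_eq_norm] using hn s hs
  · simpa [mul_comm] using hηε.le

variable {σ : ℝ → ℝ} {p : ℝ≥0∞}

lemma exists_stepFunction_eLpNorm_sub_le (hp : p ≠ ∞)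
    (hσ : MemLp σ p (volume.restrict (Set.Icc (0 : ℝ) t))) {ε : ℝ≥0∞} (hε : ε ≠ 0) :
    ∃ h : StepFunction, eLpNorm (h.toFun - σ) p (volume.restrict (Set.Icc (0 : ℝ) t)) ≤ ε := by
  obtain ⟨δ, hδ, hδε⟩ := exists_Lp_half ℝ (volume.restrict (Set.Icc (0 : ℝ) t)) p hε
  obtain ⟨g, -, hσg, hg, -⟩ := hσ.exists_hasCompactSupport_eLpNorm_sub_le hp hδ.ne'
  obtain ⟨h, hhg⟩ :=
    exists_stepFunction_eLpNorm_sub_le_of_continuousOn (t := t) hg.continuousOn p hδ.ne'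
  refine ⟨h, ?_⟩
  rw [eLpNorm_sub_comm] at hσg
  rw [← sub_add_sub_cancel h.toFun g σ]
  exact (hδε _ _ (h.measurable_toFun.aestronglyMeasurable.sub hg.aestronglyMeasurable)
    (hg.aestronglyMeasurable.sub hσ.1) hhg hσg).le

lemma exists_seq_stepFunction_tendsto (hp : p ≠ ∞)
    (hσ : MemLp σ p (volume.restrict (Set.Icc (0 : ℝ) t))) :
    ∃ h : ℕ → StepFunction, Tendsto (fun n => eLpNorm (fun s => (h n).toFun s - σ s) p
      (volume.restrict (Set.Icc (0 : ℝ) t))) atTop (𝓝 0) := by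
  choose h hh using fun n : ℕ =>
    exists_stepFunction_eLpNorm_sub_le hp hσ (ENNReal.inv_ne_zero.2 (ENNReal.natCast_ne_top n))
  exact ⟨h, tendsto_of_tendsto_of_tendsto_of_le_of_le tendsto_const_nhds
    ENNReal.tendsto_inv_nat_nhds_zero (fun _ => zero_le) hh⟩

end StepFunctionDensity

section StochasticIntegral

/-- The sum of the norms `‖f i n - g i‖` tends to `0` in `Lᵖ`, hence a.e. along a subsequence. -/
lemma exists_subseq_forall_tendsto_ae {ι α E : Type*} [Finite ι] {_ : MeasurableSpace α}
    {μ : Measure α} [NormedAddCommGroup E] {p : ℝ≥0∞} (hp : 1 ≤ p) {f : ι → ℕ → α → E}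
    {g : ι → α → E} (hf : ∀ i n, AEStronglyMeasurable (f i n) μ)
    (hg : ∀ i, AEStronglyMeasurable (g i) μ)
    (h : ∀ i, Tendsto (fun n => eLpNorm (f i n - g i) p μ) atTop (𝓝 0)) :
    ∃ ns : ℕ → ℕ, StrictMono ns ∧
      ∀ᵐ x ∂μ, ∀ i, Tendsto (fun n => f i (ns n) x) atTop (𝓝 (g i x)) := by
  have := Fintype.ofFinite ι
  let F : ℕ → α → ℝ := fun n => ∑ i, fun x => ‖(f i n - g i) x‖
  have hFm : ∀ i n, AEStronglyMeasurable (fun x => ‖(f i n - g i) x‖) μ := fun i n =>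
    ((hf i n).sub (hg i)).norm
  have hF : Tendsto (fun n => eLpNorm (F n - 0) p μ) atTop (𝓝 0) := by
    refine tendsto_of_tendsto_of_tendsto_of_le_of_le tendsto_const_nhds
      (by simpa using tendsto_finsetSum Finset.univ fun i _ => h i) (fun _ => zero_le) fun n => ?_
    calc eLpNorm (F n - 0) p μ ≤ ∑ i, eLpNorm (fun x => ‖(f i n - g i) x‖) p μ := by
          rw [sub_zero]
          exact eLpNorm_sum_le (fun i _ => hFm i n) hp
      _ = ∑ i, eLpNorm (f i n - g i) p μ := by simp only [eLpNorm_norm]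
  obtain ⟨ns, hns, hae⟩ := (tendstoInMeasure_of_tendsto_eLpNorm (zero_lt_one.trans_le hp).ne'
    (fun n => Finset.aestronglyMeasurable_sum _ fun i _ => hFm i n)
    aestronglyMeasurable_const hF).exists_seq_tendsto_ae
  refine ⟨ns, hns, hae.mono fun x hx i => tendsto_iff_norm_sub_tendsto_zero.2 ?_⟩
  refine squeeze_zero (fun _ => norm_nonneg _) (fun n => ?_) hx
  simp only [Finset.sum_apply]
  exact Finset.single_le_sum (f := fun i => ‖(f i (ns n) - g i) x‖)
    (fun _ _ => norm_nonneg _) (Finset.mem_univ i)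

variable {d : ℕ} {Ω : Type*}

lemma StepFunction.integral_eq_integral_increments (g : StepFunction)
    (B : ℝ≥0 → Ω → Particle d) (t : ℝ≥0) (ω : Ω) :
    g.integral B t ω = g.integral (fun u w => w u) t (fun u => B u ω - B 0 ω) := by
  simp only [integral, sub_sub_sub_cancel_right]

lemma StepFunction.measurable_integral [MeasurableSpace Ω] (g : StepFunction)
    {B : ℝ≥0 → Ω → Particle d} (hB : ∀ u, Measurable (B u)) (t : ℝ≥0) :
    Measurable (g.integral B t) := by
  unfold integral
  exact Finset.measurable_fun_sum _ fun k _ => ((hB _).sub (hB _)).const_smul (g.coeff k)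

/-- The functional is the pointwise limit of the elementary integrals along a subsequence for which
all the `I i` are almost sure limits. -/
lemma exists_measurable_functional_of_isStochasticIntegral {ι : Type*} [Finite ι]
    {mΩ : MeasurableSpace Ω} {P : Measure Ω} {σ : ℝ → ℝ} {B : ι → ℝ≥0 → Ω → Particle d} {t : ℝ≥0}
    {I : ι → Ω → Particle d} (hB : ∀ i u, Measurable (B i u))
    (hI : ∀ i, AEStronglyMeasurable (I i) P) (h : ∀ i, IsStochasticIntegral P σ (B i) t (I i)) :
    ∃ Ψ : (ℝ≥0 → Particle d) → Particle d, Measurable Ψ ∧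
      ∀ i, I i =ᵐ[P] fun ω => Ψ (fun u => B i u ω - B i 0 ω) := by
  rcases isEmpty_or_nonempty ι with hι | ⟨⟨i₀⟩⟩
  · exact ⟨0, measurable_const, isEmptyElim⟩
  obtain ⟨g, hg⟩ := exists_seq_stepFunction_tendsto ENNReal.ofNat_ne_top (h i₀).memLp
  obtain ⟨ns, -, hns⟩ := exists_subseq_forall_tendsto_ae one_le_two
    (f := fun i n => (g n).integral (B i) t)
    (fun i n => ((g n).measurable_integral (hB i) t).aestronglyMeasurable) hI
    fun i => (h i).tendsto g hg
  refine ⟨fun w => limUnder atTop fun n => (g (ns n)).integral (fun u w => w u) t w, ?_, ?_⟩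
  · exact (StronglyMeasurable.limUnder fun n => ((g (ns n)).measurable_integral
      (fun u => measurable_pi_apply u) t).stronglyMeasurable).measurable
  · intro i
    filter_upwards [hns] with ω hω
    simp_rw [← StepFunction.integral_eq_integral_increments]
    exact (hω i).limUnder_eq.symm

end StochasticIntegral

section WienerFamily

variable {d N : ℕ} {Ω : Type*} {mΩ : MeasurableSpace Ω} {P : Measure Ω} {ℱ : Filtration ℝ≥0 mΩ}
  {B : Fin N → ℝ≥0 → Ω → Particle d}

lemma IsIndepWienerFamily.measurable (hB : IsIndepWienerFamily P ℱ B) (i : Fin N) (u : ℝ≥0) :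
    Measurable (B i u) :=
  (hB.adapted i u).mono (ℱ.le u) le_rfl

lemma IsIndepWienerFamily.exchangeable_coords (hB : IsIndepWienerFamily P ℱ B) :
    Exchangeable P fun (p : Fin N × Fin d) ω (u : ℝ≥0) => B p.1 u ω p.2 := by
  have := hB.indep.isProbabilityMeasure
  have hcoord : ∀ p : Fin N × Fin d, AEMeasurable (fun ω (u : ℝ≥0) => B p.1 u ω p.2) P := fun p =>
    (measurable_pi_lambda _ fun u =>
      (EuclideanSpace.proj (𝕜 := ℝ) p.2).continuous.measurable.comp
        (hB.measurable p.1 u)).aemeasurable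
  refine exchangeable_of_iIndepFun_identDistrib hB.indep fun p q => ?_
  refine (identDistrib_iff_forall_finset_identDistrib (X := fun (u : ℝ≥0) ω => B p.1 u ω p.2)
    (Y := fun (u : ℝ≥0) ω => B q.1 u ω q.2) (hcoord p) (hcoord q)).2 fun J => ?_
  exact ((hB.brownian p.1 p.2).hasLaw J).identDistrib ((hB.brownian q.1 q.2).hasLaw J)

lemma IsIndepWienerFamily.exchangeable_increments (hB : IsIndepWienerFamily P ℱ B) :
    Exchangeable P fun i ω (u : ℝ≥0) => B i u ω - B i 0 ω := by
  intro τ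
  have hassemble : Measurable fun (x : Fin N × Fin d → ℝ≥0 → ℝ) (i : Fin N) (u : ℝ≥0) =>
      (WithLp.toLp 2 fun k => x (i, k) u - x (i, k) 0 : Particle d) :=
    measurable_pi_lambda _ fun i => measurable_pi_lambda _ fun u =>
      (MeasurableEquiv.toLp 2 (Fin d → ℝ)).measurable.comp (by fun_prop)
  exact (hB.exchangeable_coords (τ.prodCongr (.refl _))).comp hassemble

lemma IsIndepWienerFamily.exchangeable_prodMk_increments
    (hB : IsIndepWienerFamily P ℱ B) {E : Type*} [MeasurableSpace E] {Y : Fin N → Ω → E}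
    (hYm : ∀ i, Measurable[ℱ 0] (Y i)) (hY : Exchangeable P Y) :
    Exchangeable P fun i ω => (Y i ω, fun u : ℝ≥0 => B i u ω - B i 0 ω) := by
  have := hB.indep.isProbabilityMeasure
  refine hY.prodMk hB.exchangeable_increments ?_
  rw [IndepFun_iff_Indep]
  refine indep_of_indep_of_le_left ?_
    (Measurable.comap_le (@measurable_pi_lambda _ _ _ (ℱ 0) _ _ hYm))
  simpa only [zero_add] using hB.indep_past 0

end WienerFamily

section LusinSouslin

lemma exists_measurable_leftInvOn {C F : Type*} [MeasurableSpace C] [StandardBorelSpace C]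
    [Nonempty C] [MeasurableSpace F] [MeasurableSpace.CountablySeparated F] {G : C → F}
    (hG : Measurable G) {S : Set C} (hS : MeasurableSet S) (hinj : Set.InjOn G S) :
    ∃ H : F → C, Measurable H ∧ Set.LeftInvOn H G S := by
  have : StandardBorelSpace S := hS.standardBorel
  have hemb : MeasurableEmbedding (S.domRestrict G) :=
    (hG.comp measurable_subtype_coe).measurableEmbedding hinj.injective
  obtain ⟨H, hH, hHG⟩ :=
    hemb.exists_measurable_extend measurable_subtype_coe fun _ => inferInstance
  exact ⟨H, hH, fun x hx => congrFun hHG ⟨x, hx⟩⟩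

end LusinSouslin

section ContinuousMap

variable {α E Ω : Type*} [TopologicalSpace α] [CompactSpace α] [T2Space α]
  [SecondCountableTopology α] [NormedAddCommGroup E] [CompleteSpace E] [SecondCountableTopology E]
  [MeasurableSpace E] [BorelSpace E] [MeasurableSpace C(α, E)] [BorelSpace C(α, E)]

lemma measurable_continuousMap_of_eval [MeasurableSpace Ω] {K : Ω → C(α, E)}
    (hK : ∀ s, Measurable fun ω => K ω s) : Measurable K := by
  obtain ⟨D, hDc, hD⟩ := TopologicalSpace.exists_countable_dense α
  have := hDc.to_subtype
  have hinj : Function.Injective fun (x : C(α, E)) (s : D) => x s := fun x y hxy =>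
    ContinuousMap.coe_injective (hD.denseRange_val.equalizer x.continuous y.continuous hxy)
  exact ((continuous_pi fun s : D => continuous_eval_const _).measurableEmbedding
    hinj).measurable_comp_iff.1 (measurable_pi_lambda _ fun s => hK s)

lemma exists_measurable_continuousMap {mΩ : MeasurableSpace Ω} {P : Measure Ω} {X : α → Ω → E}
    (hX : ∀ s, Measurable (X s)) (hc : ∀ᵐ ω ∂P, Continuous fun s => X s ω) :
    ∃ K : Ω → C(α, E), Measurable K ∧ ∀ᵐ ω ∂P, ∀ s, K ω s = X s ω := by
  classical
  obtain ⟨A, hA, hAm, hPA⟩ := exists_measurable_superset_of_null (ae_iff.1 hc)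
  have hcont : ∀ ω, ω ∉ A → Continuous fun s => X s ω := fun ω hω =>
    not_not.1 fun h => hω (hA h)
  refine ⟨fun ω => if h : ω ∈ A then 0 else ⟨_, hcont ω h⟩, ?_, ?_⟩
  · refine measurable_continuousMap_of_eval fun s => ?_
    convert (hX s).indicator hAm.compl using 1
    ext ω
    by_cases h : ω ∈ A <;> simp [h]
  · filter_upwards [measure_eq_zero_iff_ae_notMem.1 hPA] with ω hω s
    simp [hω]

end ContinuousMap

section PathSpace

variable {E : Type*} [NormedAddCommGroup E] {a c : ℝ}

/-- The continuous paths on `[a, c]` along which the drift `b` is integrable. -/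
def integrablePaths (hac : a ≤ c) (b : ℝ → E → E) : Set C(Set.Icc a c, E) :=
  {x | IntegrableOn (fun s => b s (Set.IccExtend hac x s)) (Set.Icc a c)}

/-- The noise term `x t - ∫_a^t b s (x s) ds` of the path `x`, including its initial state. A path
with drift `b` and driving noise `w` is one whose noise term at each time `t` is `x a + w t`. -/
noncomputable def noiseTerm [NormedSpace ℝ E] (hac : a ≤ c) (b : ℝ → E → E) (t : Set.Icc a c)
    (x : C(Set.Icc a c, E)) : E :=
  x t - ∫ s in a..t, b s (Set.IccExtend hac x s)

variable {b : ℝ → E → E} {hac : a ≤ c}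

lemma eqOn_drift_IccExtend {b' : ℝ → E → E} (hb : Set.EqOn b' b (Set.Ico a c))
    {x : C(Set.Icc a c, E)} {y : ℝ → E} (hxy : ∀ s, x s = y s) :
    Set.EqOn (fun s => b s (Set.IccExtend hac x s)) (fun s => b' s (y s)) (Set.Ico a c) := by
  intro s hs
  simp only [Set.IccExtend_of_mem _ _ (Set.Ico_subset_Icc_self hs), hxy, hb hs]

lemma mem_integrablePaths_of_eqOn {b' : ℝ → E → E} (hb : Set.EqOn b' b (Set.Ico a c))
    {x : C(Set.Icc a c, E)} {y : ℝ → E} (hxy : ∀ s, x s = y s)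
    (hy : IntegrableOn (fun s => b' s (y s)) (Set.Icc a c)) : x ∈ integrablePaths hac b := by
  have hy' := hy.mono_set Set.Ico_subset_Icc_self
  exact (integrableOn_Icc_iff_integrableOn_Ico (by simp)).2
    (hy'.congr_fun (eqOn_drift_IccExtend hb hxy).symm measurableSet_Ico)

lemma noiseTerm_eq_of_eqOn [NormedSpace ℝ E] {b' : ℝ → E → E}
    (hb : Set.EqOn b' b (Set.Ico a c)) {x : C(Set.Icc a c, E)} {y : ℝ → E}
    (hxy : ∀ s, x s = y s) (t : Set.Icc a c) :
    noiseTerm hac b t x = y t - ∫ s in a..t, b' s (y s) := by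
  rw [noiseTerm, hxy, intervalIntegral.integral_of_le t.2.1,
    intervalIntegral.integral_of_le t.2.1, ← integral_Ico_eq_integral_Ioc,
    ← integral_Ico_eq_integral_Ioc]
  exact congrArg _ (setIntegral_congr_fun measurableSet_Ico
    ((eqOn_drift_IccExtend hb hxy).mono (Set.Ico_subset_Ico_right t.2.2)))

lemma continuous_noiseTerm [NormedSpace ℝ E] {x : C(Set.Icc a c, E)}
    (hx : x ∈ integrablePaths hac b) : Continuous fun t => noiseTerm hac b t x := by
  have hprim := intervalIntegral.continuousOn_primitive_interval (a := a) (b := c) (μ := volume)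
    (f := fun s => b s (Set.IccExtend hac x s)) (by rwa [Set.uIcc_of_le hac])
  rw [Set.uIcc_of_le hac] at hprim
  exact x.continuous.sub (continuousOn_iff_continuous_domRestrict.1 hprim)

lemma injOn_noiseTerm [NormedSpace ℝ E] (hb : IsLocallyLipschitzBefore a c b) {κ : Type*}
    {q : κ → Set.Icc a c} (hq : DenseRange q) :
    Set.InjOn (fun (x : C(Set.Icc a c, E)) (k : κ) => noiseTerm hac b (q k) x)
      (integrablePaths hac b) := by
  intro x hx y hy hxy
  have hnoise : (fun t => noiseTerm hac b t x) = fun t => noiseTerm hac b t y :=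
    hq.equalizer (continuous_noiseTerm hx) (continuous_noiseTerm hy) hxy
  have heq := hb.eqOn_of_sub_integral_eq x.continuous.Icc_extend' y.continuous.Icc_extend' hx hy
    fun t ht => by
      simpa only [noiseTerm, Set.IccExtend_of_mem _ _ ht] using congrFun hnoise ⟨t, ht⟩
  ext t
  simpa only [Set.IccExtend_val] using heq t.2

variable [SecondCountableTopology E] [MeasurableSpace E] [BorelSpace E]
  [MeasurableSpace C(Set.Icc a c, E)] [BorelSpace C(Set.Icc a c, E)]

lemma stronglyMeasurable_comp_IccExtend (hb : Measurable (Function.uncurry b)) :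
    StronglyMeasurable fun p : C(Set.Icc a c, E) × ℝ => b p.2 (Set.IccExtend hac p.1 p.2) := by
  have heval : Continuous fun p : C(Set.Icc a c, E) × ℝ => Set.IccExtend hac p.1 p.2 :=
    continuous_eval.comp
      (continuous_fst.prodMk ((continuous_projIcc (h := hac)).comp continuous_snd))
  exact (hb.comp (measurable_snd.prodMk heval.measurable)).stronglyMeasurable

lemma measurableSet_integrablePaths (hb : Measurable (Function.uncurry b)) :
    MeasurableSet (integrablePaths hac b) :=
  measurableSet_integrable (stronglyMeasurable_comp_IccExtend hb)

lemma measurable_noiseTerm [NormedSpace ℝ E] (hb : Measurable (Function.uncurry b))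
    (t : Set.Icc a c) : Measurable (noiseTerm hac b t) := by
  refine (continuous_eval_const t).measurable.sub ?_
  simp only [intervalIntegral.integral_of_le t.2.1]
  exact (stronglyMeasurable_comp_IccExtend hb).integral_prod_right.measurable

/-- The noise terms at a countable dense set of times determine the path by Grönwall's inequality,
and they do so measurably by the Lusin–Souslin theorem. -/
lemma exists_measurable_path_functional [NormedSpace ℝ E] [CompleteSpace E]
    (hb : Measurable (Function.uncurry b)) (hLip : IsLocallyLipschitzBefore a c b)
    {ι Ω F : Type*} {mΩ : MeasurableSpace Ω} {P : Measure Ω} [MeasurableSpace F]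
    {Y : ι → Ω → C(Set.Icc a c, E)} {Z : ι → Ω → F}
    (hY : ∀ i, ∀ᵐ ω ∂P, Y i ω ∈ integrablePaths hac b)
    (hYZ : ∀ t, ∃ Ψ : F → E, Measurable Ψ ∧
      ∀ i, (fun ω => noiseTerm hac b t (Y i ω)) =ᵐ[P] fun ω => Ψ (Z i ω)) :
    ∃ Φ : F → C(Set.Icc a c, E), Measurable Φ ∧ ∀ i, Y i =ᵐ[P] fun ω => Φ (Z i ω) := by
  obtain ⟨D, hDc, hD⟩ := TopologicalSpace.exists_countable_dense (Set.Icc a c)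
  have := hDc.to_subtype
  choose Ψ hΨm hΨ using hYZ
  obtain ⟨H, hH, hHinv⟩ := exists_measurable_leftInvOn
    (measurable_pi_lambda _ fun t : D => measurable_noiseTerm hb t.1)
    (measurableSet_integrablePaths hb) (injOn_noiseTerm (hac := hac) hLip hD.denseRange_val)
  refine ⟨fun z => H fun t : D => Ψ t z,
    hH.comp (measurable_pi_lambda _ fun t : D => hΨm t), fun i => ?_⟩
  filter_upwards [hY i, ae_all_iff.2 fun t : D => hΨ t i] with ω hω hΨω
  rw [← funext hΨω]
  exact (hHinv hω).symm

end PathSpace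

section Solution

variable {d N : ℕ} {Ω : Type*} {mΩ : MeasurableSpace Ω} {P : Measure Ω} {ℱ : Filtration ℝ≥0 mΩ}
  {T : ℝ≥0} {f : ℝ → Particle d → Particle d} {σ : ℝ → ℝ} {ζ : ℝ → Particle d → ℝ}
  {B X : Fin N → ℝ≥0 → Ω → Particle d}

lemma IsDenoisingSolution.measurable (hX : IsDenoisingSolution P ℱ T f σ ζ B X) (i : Fin N)
    (t : ℝ≥0) : Measurable (X i t) :=
  (hX.adapted i t).mono (ℱ.le t) le_rfl

section MeasurablePath

variable [MeasurableSpace C(Set.Icc (0 : ℝ) T, Particle d)]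
  [BorelSpace C(Set.Icc (0 : ℝ) T, Particle d)]

lemma IsDenoisingSolution.exists_measurable_path (hX : IsDenoisingSolution P ℱ T f σ ζ B X)
    (i : Fin N) : ∃ K : Ω → C(Set.Icc (0 : ℝ) T, Particle d), Measurable K ∧
      ∀ᵐ ω ∂P, ∀ s, K ω s = X i (s : ℝ).toNNReal ω := by
  refine exists_measurable_continuousMap (fun s => hX.measurable i _) ?_
  filter_upwards [hX.continuousOn i] with ω hω
  exact hω.comp_continuous (by fun_prop) fun s => Real.toNNReal_le_iff_le_coe.2 s.2.2

lemma IsDenoisingSolution.exists_noiseTerm_functional (hX : IsDenoisingSolution P ℱ T f σ ζ B X)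
    {b : ℝ → Particle d → Particle d} (hb : Measurable (Function.uncurry b))
    (hb_eq : Set.EqOn (denoisingDrift f σ ζ) b (Set.Ico 0 T))
    {K : Fin N → Ω → C(Set.Icc (0 : ℝ) T, Particle d)} (hK : ∀ i, Measurable (K i))
    (hKX : ∀ i, ∀ᵐ ω ∂P, ∀ s, K i ω s = X i (s : ℝ).toNNReal ω) (t : Set.Icc (0 : ℝ) T) :
    ∃ Ψ : Particle d × (ℝ≥0 → Particle d) → Particle d, Measurable Ψ ∧
      ∀ i, (fun ω => noiseTerm T.coe_nonneg b t (K i ω)) =ᵐ[P]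
        fun ω => Ψ (X i 0 ω, fun u => B i u ω - B i 0 ω) := by
  have ht : ((t : ℝ).toNNReal : ℝ) = t := Real.coe_toNNReal _ t.2.1
  have hnoise : ∀ i, (fun ω => noiseTerm T.coe_nonneg b t (K i ω) - X i 0 ω) =ᵐ[P]
      fun ω => X i (t : ℝ).toNNReal ω - X i 0 ω -
        ∫ s in (0 : ℝ)..(t : ℝ).toNNReal, denoisingDrift f σ ζ s (X i s.toNNReal ω) := by
    intro i
    filter_upwards [hKX i] with ω hω
    rw [noiseTerm_eq_of_eqOn hb_eq (y := fun s => X i s.toNNReal ω) hω, ht, sub_right_comm]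
  have hmeas : ∀ i, Measurable fun ω => noiseTerm T.coe_nonneg b t (K i ω) - X i 0 ω :=
    fun i => ((measurable_noiseTerm hb t).comp (hK i)).sub (hX.measurable i 0)
  obtain ⟨Ψ, hΨm, hΨ⟩ := exists_measurable_functional_of_isStochasticIntegral
    hX.wiener.measurable (fun i => (hmeas i).aestronglyMeasurable.congr (hnoise i))
    fun i => hX.equation i _ (Real.toNNReal_le_iff_le_coe.2 t.2.2)
  refine ⟨fun z => z.1 + Ψ z.2, measurable_fst.add (hΨm.comp measurable_snd), fun i => ?_⟩
  filter_upwards [(hnoise i).trans (hΨ i)] with ω hω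
  exact sub_eq_iff_eq_add'.1 hω

end MeasurablePath

lemma IsDenoisingSolution.exists_measurable_functional (hX : IsDenoisingSolution P ℱ T f σ ζ B X)
    (hf : Measurable (Function.uncurry f)) (hσ : Measurable σ)
    (hζ : Measurable (Function.uncurry ζ))
    (hζ_density : ∀ t ∈ Set.Ico (0 : ℝ) T, IsScoreDensity (ζ t))
    (hLip : IsLocallyLipschitzBefore 0 T (denoisingDrift f σ ζ)) :
    ∃ Φ : Particle d × (ℝ≥0 → Particle d) → Set.Iic T → Particle d, Measurable Φ ∧
      ∀ i, (fun ω (t : Set.Iic T) => X i t ω) =ᵐ[P]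
        fun ω => Φ (X i 0 ω, fun u => B i u ω - B i 0 ω) := by
  let _ : MeasurableSpace C(Set.Icc (0 : ℝ) T, Particle d) := borel _
  have : BorelSpace C(Set.Icc (0 : ℝ) T, Particle d) := ⟨rfl⟩
  obtain ⟨b, hb, hb_eq⟩ :=
    exists_measurable_eqOn_denoisingDrift hf hσ hζ measurableSet_Ico hζ_density
  choose K hK hKX using hX.exists_measurable_path
  have hKint : ∀ i, ∀ᵐ ω ∂P, K i ω ∈ integrablePaths T.coe_nonneg b := by
    intro i
    filter_upwards [hKX i, hX.integrableOn i] with ω hω hint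
    exact mem_integrablePaths_of_eqOn hb_eq hω hint
  obtain ⟨Φ, hΦm, hΦ⟩ := exists_measurable_path_functional hb (hLip.congr hb_eq) hKint
    (hX.exists_noiseTerm_functional hb hb_eq hK hKX)
  refine ⟨fun z t => Φ z ⟨t, t.1.2, t.2⟩,
    measurable_pi_lambda _ fun t => (continuous_eval_const _).measurable.comp hΦm, fun i => ?_⟩
  filter_upwards [hKX i, hΦ i] with ω hω hΦω
  funext t
  simp [← hΦω, hω]

lemma IsDenoisingSolution.exchangeable_paths (hX : IsDenoisingSolution P ℱ T f σ ζ B X)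
    (hf : Measurable (Function.uncurry f)) (hσ : Measurable σ)
    (hζ : Measurable (Function.uncurry ζ))
    (hζ_density : ∀ t ∈ Set.Ico (0 : ℝ) T, IsScoreDensity (ζ t))
    (hLip : IsLocallyLipschitzBefore 0 T (denoisingDrift f σ ζ))
    (hX_init : Exchangeable P fun i => X i 0) :
    Exchangeable P fun i ω (t : Set.Iic T) => X i t ω := by
  obtain ⟨Φ, hΦm, hΦ⟩ := hX.exists_measurable_functional hf hσ hζ hζ_density hLip
  have hdata := hX.wiener.exchangeable_prodMk_increments (fun i => hX.adapted i 0) hX_init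
  exact (hdata.comp hΦm).congr fun i => (hΦ i).symm

end Solution

end MeanFieldSDE

theorem mainTheorem8_general {d N : ℕ} {Ω : Type*} {mΩ : MeasurableSpace Ω} (P : Measure Ω)
    (ℱ : Filtration ℝ≥0 mΩ) (T : ℝ≥0)
    (f : ℝ → MeanFieldSDE.Particle d → MeanFieldSDE.Particle d) (σ : ℝ → ℝ)
    (ζ : ℝ → MeanFieldSDE.Particle d → ℝ)
    (hf : Measurable (Function.uncurry f)) (hσ : Measurable σ)
    (hζ : Measurable (Function.uncurry ζ))
    (hζ_density : ∀ t : ℝ, 0 ≤ t → t < T → MeanFieldSDE.IsScoreDensity (ζ t))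
    (hLip : ∀ T' : ℝ, T' < T → ∀ R : ℝ, ∃ L : ℝ≥0, ∀ t ∈ Set.Icc (0 : ℝ) T',
      LipschitzOnWith L (MeanFieldSDE.denoisingDrift f σ ζ t) (Metric.closedBall 0 R))
    (B X : Fin N → ℝ≥0 → Ω → MeanFieldSDE.Particle d)
    (hX : MeanFieldSDE.IsDenoisingSolution P ℱ T f σ ζ B X)
    (hX_init : MeanFieldSDE.Exchangeable P fun i => X i 0) :
    MeanFieldSDE.Exchangeable P (fun i ω (t : Set.Iic T) => X i t ω) ∧
      ∀ t ≤ T, ∀ ϱ : (Fin N → MeanFieldSDE.Particle d) → ℝ≥0∞, Measurable ϱ →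
        P.map (fun ω i => X i t ω) = volume.withDensity ϱ →
        ∀ τ : Equiv.Perm (Fin N), (fun x => ϱ (fun i => x (τ i))) =ᵐ[volume] ϱ := by
  have hpaths := hX.exchangeable_paths hf hσ hζ (fun t ht => hζ_density t ht.1 ht.2) hLip hX_init
  refine ⟨hpaths, fun t ht ϱ hϱ hmap τ => ?_⟩
  have hXt : MeanFieldSDE.Exchangeable P fun i => X i t :=
    hpaths.comp (measurable_pi_apply (⟨t, ht⟩ : Set.Iic T))
  exact hXt.density_comp_perm hϱ hmap τ

theorem mainTheorem8 {d N : ℕ} {Ω : Type*} {mΩ : MeasurableSpace Ω} (P : Measure Ω)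
    [IsProbabilityMeasure P] (ℱ : Filtration ℝ≥0 mΩ) (T : ℝ≥0)
    (f : ℝ → MeanFieldSDE.Particle d → MeanFieldSDE.Particle d) (σ : ℝ → ℝ)
    (ζ : ℝ → MeanFieldSDE.Particle d → ℝ)
    (hf : Measurable (Function.uncurry f)) (hσ : Measurable σ)
    (hζ : Measurable (Function.uncurry ζ))
    (hζ_density : ∀ t : ℝ, 0 ≤ t → t < T → MeanFieldSDE.IsScoreDensity (ζ t))
    (hLip : ∀ T' : ℝ, T' < T → ∀ R : ℝ, ∃ L : ℝ≥0, ∀ t ∈ Set.Icc (0 : ℝ) T',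
      LipschitzOnWith L (MeanFieldSDE.denoisingDrift f σ ζ t) (Metric.closedBall 0 R))
    (B X : Fin N → ℝ≥0 → Ω → MeanFieldSDE.Particle d)
    (hX : MeanFieldSDE.IsDenoisingSolution P ℱ T f σ ζ B X)
    (hX_init : HasLaw (fun ω i => X i 0 ω)
      (Measure.pi (fun _ : Fin N => stdGaussian (MeanFieldSDE.Particle d))) P)
    (t : ℝ≥0) (ht_pos : 0 < t) (ht_le : t ≤ T) :
    MeanFieldSDE.Exchangeable P (fun i => X i t) ∧
      ∀ ϱ : (Fin N → MeanFieldSDE.Particle d) → ℝ≥0∞, Measurable ϱ →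
        P.map (fun ω i => X i t ω) = volume.withDensity ϱ →
        ∀ τ : Equiv.Perm (Fin N), (fun x => ϱ (fun i => x (τ i))) =ᵐ[volume] ϱ := by
  obtain ⟨hpaths, hdensity⟩ := mainTheorem8_general P ℱ T f σ ζ hf hσ hζ hζ_density hLip B X hX
    (MeanFieldSDE.exchangeable_of_hasLaw_pi hX_init)
  exact ⟨hpaths.comp (measurable_pi_apply (⟨t, ht_le⟩ : Set.Iic T)), hdensity t ht_le⟩
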